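/- Let $D=2^{<\omega}$ be the set of finite binary sequences with the discrete topology, and let $\beta D$ be its Čech–Stone compactification, with $D\subseteq\beta D$ and $D^*=\beta D\setminus D$. Let $cD=D\cup 2^\omega$ be the compactification of $D$ in which the points of $D$ are isolated and each $x\in 2^\omega$ has the sets $U(x,n)=\{s\in cD: x\restriction n\subseteq s\}$, $n\in\omega$, as a local base. Let $e:\beta D\to cD$ be the continuous extension of the identity map of $D$, and for $x\in2^\omega$ put $K_x=\{u\in D^*: e(u)=x\}$. Let $\mathbb{C}=2^\omega\cup\{\infty\}$, where $\infty\notin 2^\omega$, every point of $2^\omega$ is isolated, and the sets $U$ with $\infty\in U$ and $\mathbb{C}\setminus U$ countable form a local base at $\infty$. Let $$\mathbb{A}=(\mathbb{C}\times D)\cup\bigcup_{x\in2^\omega}\{x\}\times K_x,$$ a subspace of $\mathbb{C}\times\beta D$, and let $R=\{\infty\}\times D\subseteq\mathbb{A}$. A subset $A$ of a space $X$ is $C$-embedded in $X$ if every continuous $f:A\to\mathbb{R}$ has a continuous extension $X\to\mathbb{R}$, and $C^*$-embedded in $X$ if every bounded continuous $f:A\to\mathbb{R}$ has a bounded continuous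 extension $X\to\mathbb{R}$. A space is realcompact if it can be embedded as a closed subset into a power of $\mathbb{R}$. Then $\mathbb{A}$ is realcompact; $R$ is a closed subset of $\mathbb{A}$ that is homeomorphic to the discrete space $\mathbb{N}$; $R$ is $C^*$-embedded in $\mathbb{A}$, and even in the subspace $R\cup(2^\omega\times\beta D)$ of $\mathbb{C}\times\beta D$; and $R$ is not $C$-embedded in $\mathbb{A}$. -/

import Mathlib

open Set Filter Topology

section Embedding

variable {X : Type*} [TopologicalSpace X]

/-- `A` is `C`-embedded in `X`: every continuous real-valued function on `A` extends continuously
to all of `X`. -/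
def IsCEmbedded (A : Set X) : Prop :=
  ∀ f : C(A, ℝ), ∃ g : C(X, ℝ), ∀ a : A, g a = f a

/-- `A` is `C*`-embedded in `X`: every bounded continuous real-valued function on `A` extends to a
bounded continuous function on all of `X`. -/
def IsCStarEmbedded (A : Set X) : Prop :=
  ∀ f : BoundedContinuousFunction A ℝ, ∃ g : BoundedContinuousFunction X ℝ, ∀ a : A, g a = f a

end Embedding

/-- A space is realcompact if it embeds as a closed subset into a power of the real line. -/
def IsRealcompact.{u} (X : Type u) [TopologicalSpace X] : Prop :=
  ∃ (ι : Type u) (f : X → ι → ℝ), IsClosedEmbedding f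

namespace TreePlank

/-- The Cantor set `2^ω`, used as the set of branches of the binary tree. -/
abbrev Branch : Type := ℕ → Bool

/-- The tree `D = 2^{<ω}` of finite binary sequences. -/
def Tree : Type := List Bool

/-- The tree carries the discrete topology. -/
instance : TopologicalSpace Tree := ⊥

instance : DiscreteTopology Tree := ⟨rfl⟩

/-- The list of entries of an element of the tree. -/
def Tree.toList (s : Tree) : List Bool := s

/-- The underlying set of `cD`, the disjoint union of `D` and `2^ω`. -/
inductive CTree : Type
  | node (s : Tree) : CTree
  | branch (x : Branch) : CTree

/-- The `i`-th entry of a finite or infinite binary sequence; `none` if there is no such entry. -/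
def CTree.entry : CTree → ℕ → Option Bool
  | .node s, i => s.toList[i]?
  | .branch x, i => some (x i)

/-- The wedge `U(x, n)`: all finite and infinite sequences that extend `x ↾ n`. -/
def wedge (x : Branch) (n : ℕ) : Set CTree :=
  {p | ∀ i < n, p.entry i = some (x i)}

theorem wedge_anti (x : Branch) {m n : ℕ} (h : m ≤ n) : wedge x n ⊆ wedge x m :=
  fun _ hp i hi => hp i (hi.trans_le h)

/-- In `cD` the points of `D` are isolated and the wedges `U(x, n)` form a local base at the
branch `x`. -/
instance : TopologicalSpace CTree where
  IsOpen S := ∀ x : Branch, CTree.branch x ∈ S → ∃ n, wedge x n ⊆ S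
  isOpen_univ _ _ := ⟨0, subset_univ _⟩
  isOpen_inter S T hS hT x hx := by
    obtain ⟨m, hm⟩ := hS x hx.1
    obtain ⟨n, hn⟩ := hT x hx.2
    exact ⟨max m n, subset_inter ((wedge_anti x (le_max_left m n)).trans hm)
      ((wedge_anti x (le_max_right m n)).trans hn)⟩
  isOpen_sUnion 𝒮 h𝒮 x := by
    rintro ⟨S, hS, hx⟩
    obtain ⟨n, hn⟩ := h𝒮 S hS x hx
    exact ⟨n, hn.trans (subset_sUnion_of_mem hS)⟩

theorem CTree.isOpen_iff {S : Set CTree} :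
    IsOpen S ↔ ∀ x : Branch, CTree.branch x ∈ S → ∃ n, wedge x n ⊆ S := Iff.rfl

theorem branch_mem_wedge (x : Branch) (n : ℕ) : CTree.branch x ∈ wedge x n :=
  fun _ _ => rfl

theorem isOpen_wedge (x : Branch) (n : ℕ) : IsOpen (wedge x n) := by
  intro y hy
  refine ⟨n, fun p hp i hi => ?_⟩
  rw [hp i hi]
  exact hy i hi

theorem isOpen_singleton_node (s : Tree) : IsOpen {CTree.node s} := by
  intro x hx
  simp at hx

theorem node_notMem_wedge (s : Tree) (x : Branch) :
    CTree.node s ∉ wedge x (s.toList.length + 1) := by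
  intro h
  have h1 := h s.toList.length (Nat.lt_succ_self _)
  simp [CTree.entry] at h1

theorem isOpen_compl_singleton_node (s : Tree) : IsOpen ({CTree.node s}ᶜ : Set CTree) := by
  intro x _
  refine ⟨s.toList.length + 1, fun p hp h => ?_⟩
  rw [mem_singleton_iff] at h
  exact node_notMem_wedge s x (h ▸ hp)

instance : T2Space CTree := by
  refine ⟨fun p q hpq => ?_⟩
  rcases p with s | x
  · exact ⟨_, _, isOpen_singleton_node s, isOpen_compl_singleton_node s, rfl, hpq.symm,
      disjoint_compl_right⟩
  rcases q with t | y
  · exact ⟨_, _, isOpen_compl_singleton_node t, isOpen_singleton_node t, hpq, rfl,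
      disjoint_compl_left⟩
  have hxy : x ≠ y := fun h => hpq (h ▸ rfl)
  obtain ⟨i, hi⟩ := Function.ne_iff.mp hxy
  refine ⟨_, _, isOpen_wedge x (i + 1), isOpen_wedge y (i + 1), branch_mem_wedge _ _,
    branch_mem_wedge _ _, disjoint_left.mpr fun p hp hq => hi ?_⟩
  have h1 := hp i (Nat.lt_succ_self i)
  rw [hq i (Nat.lt_succ_self i)] at h1
  exact (Option.some.inj h1).symm

instance : CompactSpace CTree := by
  refine ⟨isCompact_iff_ultrafilter_le_nhds.mpr fun F _ => ?_⟩
  have key : ∀ i, ∃ a : Option Bool, {p : CTree | p.entry i = a} ∈ F := by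
    intro i
    obtain ⟨a, ha⟩ := (F.map fun p : CTree => p.entry i).eq_pure_of_finite
    refine ⟨a, ?_⟩
    have h1 : ({a} : Set (Option Bool)) ∈ F.map fun p : CTree => p.entry i := by
      rw [ha]; exact rfl
    exact h1
  choose a ha using key
  by_cases hn : ∃ n, a n = none
  · obtain ⟨n, hn⟩ := hn
    have hfin : ({p : CTree | p.entry n = a n}).Finite := by
      refine ((List.finite_length_le Bool n).image fun s : List Bool => CTree.node s).subset ?_
      rintro (s | x) hp
      · refine ⟨s, ?_, rfl⟩
        rw [hn] at hp
        exact List.getElem?_eq_none_iff.mp hp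
      · rw [hn] at hp
        simp [CTree.entry] at hp
    obtain ⟨p, _, hp⟩ := Ultrafilter.eq_pure_of_finite_mem hfin (ha n)
    refine ⟨p, mem_univ _, ?_⟩
    rw [hp]
    exact pure_le_nhds p
  · push Not at hn
    have hx : ∀ n, ∃ b, a n = some b := fun n => Option.ne_none_iff_exists'.mp (hn n)
    choose x hx using hx
    refine ⟨.branch x, mem_univ _, fun S hS => ?_⟩
    obtain ⟨T, hTS, hT, hxT⟩ := mem_nhds_iff.mp hS
    obtain ⟨n, hn'⟩ := hT x hxT
    refine mem_of_superset ?_ (hn'.trans hTS)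
    have h1 : (⋂ i ∈ Finset.range n, {p : CTree | p.entry i = a i}) ∈ (F : Filter CTree) :=
      (biInter_finset_mem _).mpr fun i _ => ha i
    refine mem_of_superset h1 fun p hp i hi => ?_
    have h2 := mem_iInter₂.mp hp i (Finset.mem_range.mpr hi)
    exact h2.trans (hx i)

/-- The Čech-Stone compactification `βD` of the discrete space `D`. -/
abbrev BetaTree : Type := StoneCech Tree

/-- The map `e : βD → cD`, the continuous extension of the identity of `D`. -/
noncomputable def collapse : BetaTree → CTree :=
  stoneCechExtend (continuous_of_discreteTopology : Continuous CTree.node)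

/-- `D` as a subset of `βD`. -/
def treeInBeta : Set BetaTree := range stoneCechUnit

/-- The fibre `K_x` of `e` over the branch `x`, a subset of `D* = βD \ D`. -/
def fibre (x : Branch) : Set BetaTree := {u | u ∉ treeInBeta ∧ collapse u = CTree.branch x}

/-- The underlying set of `ℂ`: the set `2^ω` with one extra point `∞`. -/
inductive CocountableLine : Type
  | pt (x : Branch) : CocountableLine
  | infty : CocountableLine

/-- In `ℂ` the points of `2^ω` are isolated and the neighbourhoods of `∞` are the sets containing
`∞` whose complement is countable. -/
instance : TopologicalSpace CocountableLine where
  IsOpen S := CocountableLine.infty ∈ S → Sᶜ.Countable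
  isOpen_univ _ := by simp
  isOpen_inter S T hS hT h := by
    rw [compl_inter]
    exact (hS h.1).union (hT h.2)
  isOpen_sUnion 𝒮 h𝒮 := by
    rintro ⟨S, hS, h⟩
    exact (h𝒮 S hS h).mono (compl_subset_compl.mpr (subset_sUnion_of_mem hS))

/-- The plank `𝔸 = (ℂ × D) ∪ ⋃ₓ {x} × K_x`, a subspace of `ℂ × βD`. -/
def plank : Set (CocountableLine × BetaTree) :=
  univ ×ˢ treeInBeta ∪ ⋃ x : Branch, {CocountableLine.pt x} ×ˢ fibre x

/-- The right-hand side `R = {∞} × D`. -/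
def rightSide : Set (CocountableLine × BetaTree) :=
  {CocountableLine.infty} ×ˢ treeInBeta

/-- The larger subspace `R ∪ (2^ω × βD)` of `ℂ × βD`. -/
def bigPlank : Set (CocountableLine × BetaTree) :=
  rightSide ∪ range CocountableLine.pt ×ˢ univ

theorem rightSide_subset_plank : rightSide ⊆ plank :=
  fun _ hp => Or.inl ⟨mem_univ _, hp.2⟩

theorem plank_subset_bigPlank : plank ⊆ bigPlank := by
  rintro ⟨(x | _), u⟩ hp
  · exact Or.inr ⟨⟨x, rfl⟩, mem_univ _⟩
  · rcases hp with hp | hp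
    · exact Or.inl ⟨rfl, hp.2⟩
    · obtain ⟨x, hx, _⟩ := mem_iUnion.mp hp
      cases hx

end TreePlank

/-! For each branch `x` a continuous function `f_x` on `ℂ × βD` vanishes exactly on
`{c | c ≠ x} × K_x`, and the plank is the set where no `f_x` vanishes. Such a subset of a
realcompact space is realcompact, because the graph of `(1 / f_x)_x` is closed in a product with a
power of `ℝ`. The factor `ℂ` is realcompact for the same reason: it is a Lindelöf subspace of its
Čech–Stone compactification, and a Lindelöf subspace can be separated from each point outside it
by a zero set.

A bounded function on `R ≃ D` extends over `βD`, hence, through the second coordinate, over any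
subspace of `ℂ × βD` that contains `R`.

The function `(∞, s) ↦ |s|` has no continuous extension `g` over the plank. Each function
`c ↦ g (c, s)` is constant off a countable set, and there are countably many `s`, so some branch
`x` has `g (x, s) = |s|` for all `s`. This is unbounded on the compact set
`{x} × ({x ↾ n : n ∈ ω} ∪ K_x)`. -/

section ZeroSets

variable {X : Type*} [TopologicalSpace X]

theorem exists_continuousMap_eq_zero_iff_forall {ι : Type*} [Countable ι] (f : ι → C(X, ℝ)) :
    ∃ g : C(X, ℝ), ∀ x, g x = 0 ↔ ∀ i, f i x = 0 := by
  -- A countable power of `ℝ` is metrizable, so the distance from `0` is a single such function.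
  let := TopologicalSpace.metrizableSpaceMetric (ι → ℝ)
  refine ⟨⟨fun x => dist (fun i => f i x) 0, by fun_prop⟩, fun x => ?_⟩
  simp [funext_iff]

theorem exists_continuousMap_eq_zero_forall_ne_zero [T35Space X] {s : Set X} (hs : IsLindelof s)
    {p : X} (hp : p ∉ s) : ∃ g : C(X, ℝ), g p = 0 ∧ ∀ x ∈ s, g x ≠ 0 := by
  have hsep (x : X) (hx : x ≠ p) : ∃ f : C(X, ℝ), f p = 0 ∧ f x ≠ 0 := by
    obtain ⟨f, hf, hfp, hfx⟩ :=
      CompletelyRegularSpace.completely_regular p {x} isClosed_singleton hx.symm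
    exact ⟨⟨fun y => f y, by fun_prop⟩, by simp [hfp], by simp [hfx rfl]⟩
  choose! f hfp hfx using hsep
  have hne {x : X} (hx : x ∈ s) : x ≠ p := ne_of_mem_of_not_mem hx hp
  obtain ⟨t, ht, hts, hst⟩ := hs.elim_nhds_subcover (fun x => {y | f x y ≠ 0}) fun x hx =>
    (isOpen_ne_fun (f x).continuous continuous_const).mem_nhds (hfx x (hne hx))
  have := ht.to_subtype
  obtain ⟨g, hg⟩ := exists_continuousMap_eq_zero_iff_forall fun x : t => f x
  refine ⟨g, (hg p).mpr fun x => hfp x (hne (hts x x.2)), fun y hy hgy => ?_⟩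
  obtain ⟨x, hx, hxy⟩ := mem_iUnion₂.mp (hst hy)
  exact hxy ((hg y).mp hgy ⟨x, hx⟩)

theorem exists_continuousMap_eq_zero_iff_eq [T2Space X] [LocallyCompactSpace X]
    [FirstCountableTopology X] (a : X) : ∃ f : C(X, ℝ), ∀ x, f x = 0 ↔ x = a := by
  obtain ⟨f, hf, -⟩ := exists_continuous_one_zero_of_isCompact_of_isGδ
    isCompact_singleton (IsGδ.singleton a) isClosed_empty (disjoint_empty _)
  refine ⟨1 - f, fun x => ?_⟩
  have hfx : x = a ↔ f x = 1 := by rw [← mem_singleton_iff, hf, mem_preimage, mem_singleton_iff]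
  rw [hfx, ContinuousMap.sub_apply, ContinuousMap.one_apply, sub_eq_zero, eq_comm]

theorem eventually_eq_of_tendsto_nhds [T1Space X] [FirstCountableTopology X] {α : Type*}
    {l : Filter α} [CountableInterFilter l] {f : α → X} {a : X} (hf : Tendsto f l (𝓝 a)) :
    ∀ᶠ i in l, f i = a := by
  obtain ⟨U, hU, haU⟩ := (IsGδ.singleton a).eq_iInter_nat
  have hmem : ∀ᶠ i in l, ∀ n, f i ∈ U n := eventually_countable_forall.mpr fun n =>
    hf ((hU n).mem_nhds (mem_iInter.mp (haU ▸ mem_singleton a) n))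
  filter_upwards [hmem] with i hi
  rwa [← mem_singleton_iff, haU, mem_iInter]

end ZeroSets

section Realcompact

universe u

variable {X Y : Type u} [TopologicalSpace X] [TopologicalSpace Y]

theorem isRealcompact_pi_real (ι : Type u) : IsRealcompact (ι → ℝ) := ⟨ι, id, .id⟩

namespace IsRealcompact

theorem of_isClosedEmbedding {f : X → Y} (hY : IsRealcompact Y) (hf : IsClosedEmbedding f) :
    IsRealcompact X :=
  let ⟨ι, g, hg⟩ := hY
  ⟨ι, g ∘ f, hg.comp hf⟩

theorem prod (hX : IsRealcompact X) (hY : IsRealcompact Y) : IsRealcompact (X × Y) := by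
  obtain ⟨ι, f, hf⟩ := hX
  obtain ⟨κ, g, hg⟩ := hY
  exact (isRealcompact_pi_real (ι ⊕ κ)).of_isClosedEmbedding
    (Homeomorph.sumArrowHomeomorphProdArrow.symm.isClosedEmbedding.comp (hf.prodMap hg))

theorem of_compactSpace [CompactSpace X] [T2Space X] : IsRealcompact X := by
  refine ⟨C(X, ℝ), fun x f => f x, Continuous.isClosedEmbedding (by fun_prop) fun x y hxy => ?_⟩
  by_contra hne
  obtain ⟨f, hf, hfxy⟩ := separatesPoints_continuous_of_t35Space hne
  exact hfxy (congrFun hxy ⟨f, hf⟩)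

theorem setOf_forall_ne_zero {ι : Type u} (hX : IsRealcompact X) (f : ι → C(X, ℝ)) :
    IsRealcompact {x | ∀ i, f i x ≠ 0} := by
  let graph : {x | ∀ i, f i x ≠ 0} → X × (ι → ℝ) := fun x => (x, fun i => (f i x)⁻¹)
  have hcont : Continuous graph := by
    refine continuous_subtype_val.prodMk (continuous_pi fun i => ?_)
    exact ((f i).continuous.comp continuous_subtype_val).inv₀ fun x => x.2 i
  have hrange : range graph = {p | ∀ i, f i p.1 * p.2 i = 1} := by
    ext ⟨x, z⟩
    constructor
    · rintro ⟨y, hy⟩ i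
      cases hy
      exact mul_inv_cancel₀ (y.2 i)
    · intro hxz
      refine ⟨⟨x, fun i => left_ne_zero_of_mul_eq_one (hxz i)⟩, Prod.ext rfl (funext fun i => ?_)⟩
      exact (eq_inv_of_mul_eq_one_right (hxz i)).symm
  have hclosed : IsClosed {p : X × (ι → ℝ) | ∀ i, f i p.1 * p.2 i = 1} := by
    simp only [ofPred_forall]
    exact isClosed_iInter fun i => isClosed_eq (by fun_prop) continuous_const
  have hemb : IsEmbedding graph := .of_comp hcont continuous_fst .subtypeVal
  exact (hX.prod (isRealcompact_pi_real ι)).of_isClosedEmbedding ⟨hemb, hrange ▸ hclosed⟩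

theorem t35Space (hX : IsRealcompact X) : T35Space X :=
  let ⟨_, _, hf⟩ := hX
  hf.isEmbedding.t35Space

theorem of_isLindelof {s : Set X} (hX : IsRealcompact X) (hs : IsLindelof s) :
    IsRealcompact s := by
  have := hX.t35Space
  choose g hgp hgs using fun p : ↥(sᶜ) => exists_continuousMap_eq_zero_forall_ne_zero hs p.2
  have heq : s = {x | ∀ p, g p x ≠ 0} := by
    ext x
    exact ⟨fun hx p => hgs p x hx, fun h => by_contra fun hx => h ⟨x, hx⟩ (hgp ⟨x, hx⟩)⟩
  rw [heq]
  exact hX.setOf_forall_ne_zero g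

theorem of_lindelofSpace [T35Space X] [LindelofSpace X] : IsRealcompact X :=
  (of_compactSpace.of_isLindelof (isLindelof_range continuous_stoneCechUnit)).of_isClosedEmbedding
    isEmbedding_stoneCechUnit.toHomeomorph.isClosedEmbedding

end IsRealcompact

end Realcompact

section CStarEmbedded

variable {X T : Type*} [TopologicalSpace X] [TopologicalSpace T]

theorem exists_stoneCech_extension {α : Type*} [MetricSpace α] [ProperSpace α]
    (f : BoundedContinuousFunction T α) :
    ∃ g : C(StoneCech T, α), ∀ t, g (stoneCechUnit t) = f t := by
  have := isCompact_iff_compactSpace.mp f.isBounded_range.isCompact_closure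
  let φ : T → closure (range f) := fun t => ⟨f t, subset_closure ⟨t, rfl⟩⟩
  have hφ : Continuous φ := by fun_prop
  refine ⟨⟨fun u => (stoneCechExtend hφ u : closure (range f)), ?_⟩, fun t => ?_⟩
  · exact continuous_subtype_val.comp (continuous_stoneCechExtend hφ)
  · exact congrArg Subtype.val (stoneCechExtend_stoneCechUnit hφ t)

theorem isCStarEmbedded_of_homeomorph {A : Set X} (e : A ≃ₜ T) (q : C(X, StoneCech T))
    (hq : ∀ a : A, q a = stoneCechUnit (e a)) : IsCStarEmbedded A := by
  intro f
  obtain ⟨g, hg⟩ := exists_stoneCech_extension (f.compContinuous ⟨e.symm, e.symm.continuous⟩)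
  refine ⟨(BoundedContinuousFunction.mkOfCompact g).compContinuous q, fun a => ?_⟩
  simp [hq, hg]

end CStarEmbedded

namespace TreePlank

section CTree

instance : FirstCountableTopology CTree := by
  refine ⟨fun p => ?_⟩
  rcases p with s | x
  · rw [(isOpen_singleton_iff_nhds_eq_pure _).mp (isOpen_singleton_node s)]
    infer_instance
  · have hbasis : (𝓝 (CTree.branch x)).HasBasis (fun _ => True) (wedge x) := by
      refine ⟨fun S => ⟨fun hS => ?_, fun ⟨n, _, hn⟩ => ?_⟩⟩
      · obtain ⟨T, hTS, hT, hxT⟩ := mem_nhds_iff.mp hS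
        obtain ⟨n, hn⟩ := hT x hxT
        exact ⟨n, trivial, hn.trans hTS⟩
      · exact mem_of_superset ((isOpen_wedge x n).mem_nhds (branch_mem_wedge x n)) hn
    exact hbasis.isCountablyGenerated

/-- The initial segment `x ↾ n` of a branch. -/
def Branch.restrict (x : Branch) (n : ℕ) : Tree := List.ofFn fun i : Fin n => x i

theorem Branch.length_restrict (x : Branch) (n : ℕ) : (Branch.restrict x n).toList.length = n :=
  List.length_ofFn

theorem Branch.node_restrict_mem_wedge (x : Branch) {m n : ℕ} (h : m ≤ n) :
    CTree.node (Branch.restrict x n) ∈ wedge x m := by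
  intro i hi
  simp [CTree.entry, Branch.restrict, Tree.toList, hi.trans_le h]

theorem Branch.tendsto_node_restrict (x : Branch) :
    Tendsto (fun n => CTree.node (Branch.restrict x n)) atTop (𝓝 (.branch x)) := by
  refine tendsto_nhds.mpr fun S hS hx => ?_
  obtain ⟨m, hm⟩ := hS x hx
  filter_upwards [eventually_ge_atTop m] with n hn
  exact hm (Branch.node_restrict_mem_wedge x hn)

instance : Uncountable Branch := by
  refine uncountable_iff_forall_not_surjective.mpr fun f hf => ?_
  obtain ⟨n, hn⟩ := hf fun n => !f n n
  simpa using congrFun hn n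

end CTree

section BetaTree

instance : Countable Tree := inferInstanceAs (Countable (List Bool))

instance : Infinite Tree := inferInstanceAs (Infinite (List Bool))

theorem continuous_collapse : Continuous collapse := continuous_stoneCechExtend _

theorem collapse_stoneCechUnit (s : Tree) : collapse (stoneCechUnit s) = .node s :=
  stoneCechExtend_stoneCechUnit _ s

theorem collapse_eq_node_iff {u : BetaTree} {s : Tree} :
    collapse u = .node s ↔ u = stoneCechUnit s := by
  refine ⟨fun h => ?_, fun h => h ▸ collapse_stoneCechUnit s⟩
  by_contra hu
  have hopen : IsOpen (collapse ⁻¹' {.node s} ∩ {stoneCechUnit s}ᶜ) :=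
    ((isOpen_singleton_node s).preimage continuous_collapse).inter isOpen_compl_singleton
  obtain ⟨t, ht, hts⟩ := denseRange_stoneCechUnit.exists_mem_open hopen ⟨u, h, hu⟩
  rw [mem_preimage, collapse_stoneCechUnit, mem_singleton_iff, CTree.node.injEq] at ht
  exact hts (congrArg stoneCechUnit ht)

theorem mem_treeInBeta_iff {u : BetaTree} : u ∈ treeInBeta ↔ ∀ x, collapse u ≠ .branch x := by
  constructor
  · rintro ⟨s, rfl⟩ x
    simp [collapse_stoneCechUnit]
  · intro hu
    rcases h : collapse u with s | x
    · exact ⟨s, (collapse_eq_node_iff.mp h).symm⟩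
    · exact absurd h (hu x)

theorem mem_fibre_iff {u : BetaTree} {x : Branch} : u ∈ fibre x ↔ collapse u = .branch x :=
  ⟨And.right, fun h => ⟨fun hu => mem_treeInBeta_iff.mp hu x h, h⟩⟩

end BetaTree

namespace CocountableLine

theorem isOpen_of_infty_notMem {S : Set CocountableLine} (h : infty ∉ S) : IsOpen S :=
  fun h' => absurd h' h

theorem mem_nhds_infty_iff {S : Set CocountableLine} :
    S ∈ 𝓝 infty ↔ infty ∈ S ∧ Sᶜ.Countable := by
  refine ⟨fun h => ⟨mem_of_mem_nhds h, ?_⟩, fun ⟨h, hS⟩ => IsOpen.mem_nhds (fun _ => hS) h⟩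
  obtain ⟨T, hTS, hT, hinfty⟩ := mem_nhds_iff.mp h
  exact (hT hinfty).mono (compl_subset_compl.mpr hTS)

instance : CountableInterFilter (𝓝 infty) := by
  refine ⟨fun 𝒮 hc h𝒮 => mem_nhds_infty_iff.mpr ⟨fun S hS => mem_of_mem_nhds (h𝒮 S hS), ?_⟩⟩
  rw [compl_sInter, sUnion_image]
  exact hc.biUnion fun S hS => (mem_nhds_infty_iff.mp (h𝒮 S hS)).2

instance : T1Space CocountableLine := by
  refine ⟨fun c => ⟨fun _ => ?_⟩⟩
  rw [compl_compl]
  exact countable_singleton c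

theorem isClopen_singleton_pt (x : Branch) : IsClopen {pt x} :=
  ⟨isClosed_singleton, isOpen_of_infty_notMem (by simp)⟩

instance : NormalSpace CocountableLine := by
  refine ⟨fun S T hS hT hST => ?_⟩
  by_cases h : infty ∈ S
  · have hT' : IsOpen T := isOpen_of_infty_notMem (disjoint_left.mp hST h)
    exact ⟨Tᶜ, T, hT.isOpen_compl, hT', hST.subset_compl_right, subset_rfl, disjoint_compl_left⟩
  · exact ⟨S, Sᶜ, isOpen_of_infty_notMem h, hS.isOpen_compl, subset_rfl, hST.subset_compl_left,
      disjoint_compl_right⟩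

instance : LindelofSpace CocountableLine := by
  refine ⟨isLindelof_of_countable_subcover fun U hU hcover => ?_⟩
  obtain ⟨i, hi⟩ := mem_iUnion.mp (hcover (mem_univ infty))
  have hcompl : (U i)ᶜ.Countable := hU i hi
  obtain ⟨t, ht, hsub⟩ :=
    hcompl.isLindelof.elim_countable_subcover U hU ((subset_univ _).trans hcover)
  refine ⟨insert i t, ht.insert i, ?_⟩
  rw [biUnion_insert]
  exact (compl_subset_iff_union.mp hsub).ge

theorem exists_forall_pt_eq_infty {ι Y : Type*} [Countable ι] [TopologicalSpace Y] [T1Space Y]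
    [FirstCountableTopology Y] {h : ι → CocountableLine → Y} (hh : ∀ i, Continuous (h i)) :
    ∃ x, ∀ i, h i (pt x) = h i infty := by
  have hev : ∀ᶠ c in 𝓝 infty, ∀ i, h i c = h i infty :=
    eventually_countable_forall.mpr fun i => eventually_eq_of_tendsto_nhds ((hh i).tendsto infty)
  have hcount : (pt ⁻¹' {c | ∀ i, h i c = h i infty}ᶜ).Countable :=
    (mem_nhds_infty_iff.mp hev).2.preimage fun _ _ => pt.inj
  by_contra! hne
  refine not_countable_univ (hcount.mono fun x _ hx => ?_)
  obtain ⟨i, hi⟩ := hne x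
  exact hi (hx i)

end CocountableLine

section Plank

theorem mem_plank_iff {p : CocountableLine × BetaTree} :
    p ∈ plank ↔ ∀ x, collapse p.2 = .branch x → p.1 = .pt x := by
  simp only [plank, mem_union, mem_prod, mem_univ, true_and, mem_treeInBeta_iff, mem_iUnion,
    mem_singleton_iff, mem_fibre_iff]
  rcases collapse p.2 with s | y <;> simp

theorem exists_continuousMap_eq_zero_iff_pt_ne_and_collapse_eq (x : Branch) :
    ∃ f : C(CocountableLine × BetaTree, ℝ),
      ∀ p, f p = 0 ↔ p.1 ≠ .pt x ∧ collapse p.2 = .branch x := by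
  obtain ⟨h, hh⟩ := exists_continuousMap_eq_zero_iff_eq (CTree.branch x)
  let χ : C(CocountableLine, ℝ) :=
    ⟨indicator {.pt x} 1,
      (CocountableLine.isClopen_singleton_pt x).continuous_indicator continuous_one⟩
  obtain ⟨f, hf⟩ := exists_continuousMap_eq_zero_iff_forall fun i : Bool =>
    i.rec (χ.comp .fst) (h.comp (.comp ⟨collapse, continuous_collapse⟩ .snd))
  refine ⟨f, fun p => ?_⟩
  simp [hf, hh, χ]

theorem isRealcompact_plank : IsRealcompact plank := by
  choose f hf using exists_continuousMap_eq_zero_iff_pt_ne_and_collapse_eq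
  have heq : plank = {p | ∀ x, f x p ≠ 0} := by
    ext p
    simp only [mem_plank_iff, mem_ofPred_eq, ne_eq, hf, not_and', not_not]
  rw [heq]
  exact (IsRealcompact.of_lindelofSpace.prod .of_compactSpace).setOf_forall_ne_zero f

theorem isClosed_rightSide : IsClosed ((↑) ⁻¹' rightSide : Set plank) := by
  have heq : ((↑) ⁻¹' rightSide : Set plank) = (fun p => p.1.1) ⁻¹' {.infty} := by
    ext p
    refine ⟨And.left, fun h => ⟨h, mem_treeInBeta_iff.mpr fun x hx => ?_⟩⟩
    cases (mem_plank_iff.mp p.2 x hx).symm.trans h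
  rw [heq]
  exact isClosed_singleton.preimage (by fun_prop)

end Plank

section RightSide

variable {Y : Set (CocountableLine × BetaTree)}

/-- The point `(∞, s)` of `R`, for `R` seen as a subset of a subspace `Y ⊇ R` of `ℂ × βD`. -/
def rightPoint (hY : rightSide ⊆ Y) (s : Tree) : ((↑) ⁻¹' rightSide : Set Y) :=
  ⟨⟨(.infty, stoneCechUnit s), hY ⟨rfl, s, rfl⟩⟩, rfl, s, rfl⟩

theorem isEmbedding_rightPoint (hY : rightSide ⊆ Y) : IsEmbedding (rightPoint hY) :=
  .of_comp (f := rightPoint hY) (g := fun a => a.1.1.2) continuous_of_discreteTopology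
    (by fun_prop) isEmbedding_stoneCechUnit

theorem surjective_rightPoint (hY : rightSide ⊆ Y) : Function.Surjective (rightPoint hY) := by
  rintro ⟨p, hc, s, hs⟩
  exact ⟨s, Subtype.ext (Subtype.ext (Prod.ext hc.symm hs))⟩

/-- The homeomorphism of `R` with `D` that drops the coordinate `∞`; as in `rightPoint`, `R` is seen
as a subset of `Y`. -/
noncomputable def rightSideHomeomorph (hY : rightSide ⊆ Y) :
    ((↑) ⁻¹' rightSide : Set Y) ≃ₜ Tree :=
  ((isEmbedding_rightPoint hY).toHomeomorphOfSurjective (surjective_rightPoint hY)).symm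

theorem stoneCechUnit_rightSideHomeomorph (hY : rightSide ⊆ Y)
    (a : ((↑) ⁻¹' rightSide : Set Y)) : stoneCechUnit (rightSideHomeomorph hY a) = a.1.1.2 := by
  obtain ⟨s, rfl⟩ := (rightSideHomeomorph hY).symm.surjective a
  rw [Homeomorph.apply_symm_apply]
  rfl

theorem nonempty_rightSide_homeomorph_nat (hY : rightSide ⊆ Y) :
    Nonempty (((↑) ⁻¹' rightSide : Set Y) ≃ₜ ℕ) :=
  let ⟨e⟩ := nonempty_equiv_of_countable (α := Tree) (β := ℕ)
  ⟨(rightSideHomeomorph hY).trans e.toHomeomorphOfDiscrete⟩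

theorem isCStarEmbedded_rightSide (hY : rightSide ⊆ Y) :
    IsCStarEmbedded ((↑) ⁻¹' rightSide : Set Y) :=
  isCStarEmbedded_of_homeomorph (rightSideHomeomorph hY) ⟨fun p => p.1.2, by fun_prop⟩
    fun a => (stoneCechUnit_rightSideHomeomorph hY a).symm

end RightSide

section NotCEmbedded

/-- The point `(c, s)` of `ℂ × D ⊆ 𝔸`, on which extensions of functions on `R` are evaluated. -/
def treePoint (c : CocountableLine) (s : Tree) : plank :=
  ⟨(c, stoneCechUnit s), .inl ⟨mem_univ c, s, rfl⟩⟩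

theorem continuous_treePoint (s : Tree) : Continuous fun c => treePoint c s := by
  unfold treePoint
  fun_prop

-- The set is `{x} × ({x ↾ n : n ∈ ω} ∪ K_x)`.
theorem isCompact_column (x : Branch) :
    IsCompact {p : plank | p.1.1 = .pt x ∧
      collapse p.1.2 ∈ insert (.branch x) (range fun n => .node (Branch.restrict x n))} := by
  set S : Set CTree := insert (.branch x) (range fun n => .node (Branch.restrict x n)) with hS
  have hScompact : IsCompact S := (Branch.tendsto_node_restrict x).isCompact_insert_range
  have hsub : {CocountableLine.pt x} ×ˢ (collapse ⁻¹' S) ⊆ plank := by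
    rintro ⟨_, u⟩ ⟨rfl, hu⟩
    refine mem_plank_iff.mpr fun y hy => ?_
    simpa [hS, hy, eq_comm] using hu
  refine (IsInducing.subtypeVal.isCompact_preimage_iff
    (K := {CocountableLine.pt x} ×ˢ (collapse ⁻¹' S)) (by rwa [Subtype.range_coe])).mpr ?_
  exact isCompact_singleton.prod (hScompact.isClosed.preimage continuous_collapse).isCompact

theorem bddAbove_range_treePoint_restrict (x : Branch) {g : plank → ℝ} (hg : Continuous g) :
    BddAbove (range fun n => g (treePoint (.pt x) (Branch.restrict x n))) := by
  refine ((isCompact_column x).bddAbove_image hg.continuousOn).mono ?_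
  rintro _ ⟨n, rfl⟩
  exact ⟨_, ⟨rfl, .inr ⟨n, (collapse_stoneCechUnit _).symm⟩⟩, rfl⟩

theorem not_isCEmbedded_rightSide : ¬ IsCEmbedded ((↑) ⁻¹' rightSide : Set plank) := by
  intro hC
  let e := rightSideHomeomorph rightSide_subset_plank
  have hlength : Continuous fun s : Tree => (s.toList.length : ℝ) := continuous_of_discreteTopology
  obtain ⟨g, hg⟩ := hC ⟨_, hlength.comp e.continuous⟩
  have hinfty (s : Tree) : g (treePoint .infty s) = s.toList.length := by
    refine (hg (e.symm s)).trans ?_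
    simp only [ContinuousMap.coe_mk, Function.comp_apply, Homeomorph.apply_symm_apply]
  obtain ⟨x, hx⟩ := CocountableLine.exists_forall_pt_eq_infty fun s =>
    g.continuous.comp (continuous_treePoint s)
  obtain ⟨b, hb⟩ := bddAbove_range_treePoint_restrict x g.continuous
  obtain ⟨n, hn⟩ := exists_nat_gt b
  have hgn : g (treePoint (.pt x) (x.restrict n)) = n :=
    calc g (treePoint (.pt x) (x.restrict n)) = g (treePoint .infty (x.restrict n)) := hx _
      _ = (x.restrict n).toList.length := hinfty _
      _ = n := by rw [x.length_restrict]
  exact hn.not_ge (hgn ▸ hb ⟨n, rfl⟩)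

end NotCEmbedded

end TreePlank

theorem mainTheorem1 :
    IsRealcompact TreePlank.plank ∧
    IsClosed ((↑) ⁻¹' TreePlank.rightSide : Set TreePlank.plank) ∧
    Nonempty (((↑) ⁻¹' TreePlank.rightSide : Set TreePlank.plank) ≃ₜ ℕ) ∧
    IsCStarEmbedded ((↑) ⁻¹' TreePlank.rightSide : Set TreePlank.plank) ∧
    IsCStarEmbedded ((↑) ⁻¹' TreePlank.rightSide : Set TreePlank.bigPlank) ∧
    ¬ IsCEmbedded ((↑) ⁻¹' TreePlank.rightSide : Set TreePlank.plank) :=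
  ⟨TreePlank.isRealcompact_plank,
    TreePlank.isClosed_rightSide,
    TreePlank.nonempty_rightSide_homeomorph_nat TreePlank.rightSide_subset_plank,
    TreePlank.isCStarEmbedded_rightSide TreePlank.rightSide_subset_plank,
    TreePlank.isCStarEmbedded_rightSide
      (TreePlank.rightSide_subset_plank.trans TreePlank.plank_subset_bigPlank),
    TreePlank.not_isCEmbedded_rightSide⟩
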